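/- There exist four pairwise commuting complex $3\times 3$ matrices $A_1,A_2,A_3,A_4$ that are contractions ($\|A_i\|\le 1$ for the operator norm on $\mathbb{C}^3$ with its Euclidean norm) and satisfy the von Neumann inequality $$\|p(A_1,A_2,A_3,A_4)\|\le \sup\{|p(z_1,z_2,z_3,z_4)| : z_i\in\mathbb{C},\ |z_i|\le 1\ (1\le i\le 4)\}$$ for every complex polynomial $p$ in four variables, but that do not coextend to commuting isometries: there are no complex Hilbert space $K$, linear isometric embedding $J:\mathbb{C}^3\to K$ and pairwise commuting linear isometries $V_1,V_2,V_3,V_4:K\to K$ with $V_i^*J=JA_i^*$ for $1\le i\le 4$ (that is, $J(\mathbb{C}^3)$ is invariant under each $V_i^*$, and $V_i^*$ restricts to $A_i^*$ there). -/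

import Mathlib

universe u v

/-- The value `p(T₀, …, Tₙ₋₁) = ∑ₘ cₘ T₀ ^ m₀ ⋯ Tₙ₋₁ ^ mₙ₋₁` of a complex polynomial
`p = ∑ₘ cₘ z ^ m` at a tuple of operators (used for commuting tuples, where the order of the
factors is irrelevant). -/
noncomputable def polyEval {n : ℕ} {H : Type*} [NormedAddCommGroup H] [InnerProductSpace ℂ H]
    (T : Fin n → (H →L[ℂ] H)) (p : MvPolynomial (Fin n) ℂ) : H →L[ℂ] H :=
  ∑ m ∈ p.support, p.coeff m • (List.ofFn fun i => T i ^ m i).prod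

/-- The closed unit polydisc in `ℂⁿ`. -/
def closedPolydisc (n : ℕ) : Set (Fin n → ℂ) := {z | ∀ i, ‖z i‖ ≤ 1}

/-- The supremum norm of a polynomial on the closed unit polydisc. -/
noncomputable def polydiscNorm {n : ℕ} (p : MvPolynomial (Fin n) ℂ) : ℝ :=
  sSup ((fun z : Fin n → ℂ => ‖MvPolynomial.eval z p‖) '' closedPolydisc n)

/-- The set of values defining `polydiscNorm` is bounded, so the supremum is a genuine one. -/
theorem bddAbove_polydisc {n : ℕ} (p : MvPolynomial (Fin n) ℂ) :
    BddAbove ((fun z : Fin n → ℂ => ‖MvPolynomial.eval z p‖) '' closedPolydisc n) := by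
  have h : closedPolydisc n = Metric.closedBall 0 1 := by
    ext z
    simp [closedPolydisc, pi_norm_le_iff_of_nonneg]
  rw [h]
  exact ((isCompact_closedBall _ _).image (MvPolynomial.continuous_eval p).norm).bddAbove

/-- The (scalar) von Neumann inequality `‖p(T)‖ ≤ sup {|p(z)| : |zᵢ| ≤ 1}` for all complex
polynomials `p`. -/
def SatisfiesVonNeumann {n : ℕ} {H : Type*} [NormedAddCommGroup H] [InnerProductSpace ℂ H]
    (T : Fin n → (H →L[ℂ] H)) : Prop :=
  ∀ p : MvPolynomial (Fin n) ℂ, ‖polyEval T p‖ ≤ polydiscNorm p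

/-- `T` coextends to commuting isometries: there are a complex Hilbert space `K`, an isometric
embedding `J` of `H` into `K`, and commuting isometries `Vᵢ` of `K` such that `J(H)` is invariant
under each `Vᵢ*`, and `Vᵢ*` restricts to `Tᵢ*` there. In other words, with respect to
`K = H ⊕ Hᗮ` the operator `Vᵢ` is lower triangular, with first row `(Tᵢ, 0)`. -/
def CoextendsToCommutingIsometries {n : ℕ} {H : Type v} [NormedAddCommGroup H]
    [InnerProductSpace ℂ H] [CompleteSpace H] (T : Fin n → (H →L[ℂ] H)) : Prop :=
  ∃ (K : Type u) (_ : NormedAddCommGroup K) (_ : InnerProductSpace ℂ K) (_ : CompleteSpace K)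
    (J : H →ₗᵢ[ℂ] K) (V : Fin n → (K →L[ℂ] K)),
    (∀ i, Isometry (V i)) ∧ (∀ i j, Commute (V i) (V j)) ∧
      ∀ i (x : H), ContinuousLinearMap.adjoint (V i) (J x) =
        J (ContinuousLinearMap.adjoint (T i) x)

open scoped InnerProductSpace ComplexConjugate

/-! Take `A i = v i e*` with unit vectors `v i ⊥ e`. All products vanish, so `p(A) = p(0) + w e*`
with `w = ∑ ∂ᵢp(0) v i`. Such an operator has norm at most `M` once `M‖w‖ ≤ M² - |p(0)|²`, and
Schwarz–Pick on a well-chosen complex line gives `M ∑ |∂ᵢp(0)| ≤ M² - |p(0)|²`; hence von Neumann's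
inequality (`satisfiesVonNeumann_rankOne`). Since `A i` attains its norm at `e`, a coextension must
satisfy `V i e = v i` (`apply_eq_of_adjoint_apply_eq`). The vectors `v i` lie in a plane;
commutation expresses each `V i` on that plane through `V 0` and `V 1`, and preservation of inner
products then forces contradictory values of one of them (`false_of_commuting_isometries`). -/

/-- Evaluation of a polynomial at the standard square zero tuple records its affine part. -/
theorem aeval_inr_single {σ : Type*} [DecidableEq σ] (p : MvPolynomial σ ℂ) :
    MvPolynomial.aeval (fun i => (TrivSqZeroExt.inr (Pi.single i 1) : TrivSqZeroExt ℂ (σ → ℂ))) p =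
      TrivSqZeroExt.inl (MvPolynomial.eval 0 p) +
        TrivSqZeroExt.inr fun i => MvPolynomial.eval 0 (MvPolynomial.pderiv i p) := by
  induction p using MvPolynomial.induction_on with
  | C a => ext <;> simp [TrivSqZeroExt.algebraMap_eq_inl]
  | add p q hp hq =>
    rw [map_add, hp, hq]
    ext <;> simp
  | mul_X p i hp =>
    rw [map_mul, hp, MvPolynomial.aeval_X]
    ext j
    · simp
    · by_cases h : i = j <;>
        simp [Derivation.leibniz, MvPolynomial.pderiv_X, Pi.single_apply, h, Ne.symm]

/-- A polynomial evaluated at operators with vanishing pairwise products is its affine part. -/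
theorem polyEval_of_mul_eq_zero {n : ℕ} {H : Type*} [NormedAddCommGroup H]
    [InnerProductSpace ℂ H] (T : Fin n → (H →L[ℂ] H)) (hT : ∀ i j, T i * T j = 0)
    (p : MvPolynomial (Fin n) ℂ) :
    polyEval T p = MvPolynomial.eval 0 p • (1 : H →L[ℂ] H) +
      ∑ i, MvPolynomial.eval 0 (MvPolynomial.pderiv i p) • T i := by
  let g : (Fin n → ℂ) →ₗ[ℂ] (H →L[ℂ] H) := Fintype.linearCombination ℂ T
  have hg : ∀ x y, g x * g y = 0 := fun x y => by
    simp [g, Fintype.linearCombination_apply, Finset.sum_mul_sum, hT]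
  -- By `hg`, `g` extends to an algebra homomorphism from the square zero extension, so `p(T)` is
  -- the image of `p(ε)`.
  let φ := TrivSqZeroExt.liftEquivOfComm (R' := ℂ) ⟨g, hg⟩
  let ε : Fin n → TrivSqZeroExt ℂ (Fin n → ℂ) := fun i => TrivSqZeroExt.inr (Pi.single i 1)
  have hε : ∀ i, φ (ε i) = T i := fun i => by
    simp [φ, ε, g, TrivSqZeroExt.liftEquivOfComm_apply, Fintype.linearCombination_apply_single]
  have h₁ : polyEval T p = φ (MvPolynomial.aeval ε p) := by
    rw [MvPolynomial.aeval_def, MvPolynomial.eval₂_eq', map_sum, polyEval]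
    refine Finset.sum_congr rfl fun m _ => ?_
    rw [← Algebra.smul_def, map_smul, ← List.prod_ofFn, map_list_prod, List.map_ofFn]
    simp [Function.comp_def, hε]
  rw [h₁, aeval_inr_single, map_add]
  congr 1
  · simp [φ, TrivSqZeroExt.liftEquivOfComm_apply, Algebra.algebraMap_eq_smul_one]
  · simp [φ, g, TrivSqZeroExt.liftEquivOfComm_apply, Fintype.linearCombination_apply]

/-- The derivative at the origin of a polynomial restricted to a complex line. -/
theorem hasDerivAt_eval_smul {σ : Type*} [Fintype σ] (p : MvPolynomial σ ℂ) (z : σ → ℂ) :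
    HasDerivAt (fun ζ : ℂ => MvPolynomial.eval (ζ • z) p)
      (∑ i, z i * MvPolynomial.eval 0 (MvPolynomial.pderiv i p)) 0 := by
  classical
  induction p using MvPolynomial.induction_on with
  | C a => simpa using hasDerivAt_const (0 : ℂ) a
  | add p q hp hq =>
    simp only [map_add, mul_add, Finset.sum_add_distrib]
    exact hp.add hq
  | mul_X p i hp =>
    have h := hp.mul ((hasDerivAt_id (0 : ℂ)).mul_const (z i))
    simp only [map_mul, MvPolynomial.eval_X, Pi.smul_apply, smul_eq_mul]
    refine h.congr_deriv ?_
    simp [Derivation.leibniz, MvPolynomial.pderiv_X, Pi.single_apply, mul_comm,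
      apply_ite MvPolynomial.constantCoeff]

/-- A polynomial restricted to a complex line is an entire function. -/
theorem differentiable_eval_smul {σ : Type*} (p : MvPolynomial σ ℂ) (z : σ → ℂ) :
    Differentiable ℂ fun ζ : ℂ => MvPolynomial.eval (ζ • z) p := by
  induction p using MvPolynomial.induction_on with
  | C a => simp
  | add p q hp hq =>
    simp only [map_add]
    exact hp.add hq
  | mul_X p i hp =>
    simp only [map_mul, MvPolynomial.eval_X, Pi.smul_apply, smul_eq_mul]
    exact hp.mul (by fun_prop)

/-- The **Schwarz–Pick inequality** at the centre of the disc. -/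
theorem mul_norm_deriv_zero_le {f : ℂ → ℂ} {M : ℝ} (hd : Differentiable ℂ f)
    (hM : ∀ ζ ∈ Metric.ball (0 : ℂ) 1, ‖f ζ‖ ≤ M) (h0 : ‖f 0‖ < M) :
    M * ‖deriv f 0‖ ≤ M ^ 2 - ‖f 0‖ ^ 2 := by
  have hM0 : 0 < M := (norm_nonneg _).trans_lt h0
  set a := f 0 with ha
  have hden : ∀ ζ ∈ Metric.ball (0 : ℂ) 1, (M : ℂ) ^ 2 - conj a * f ζ ≠ 0 := fun ζ hζ h => by
    have h' : ‖(M : ℂ) ^ 2‖ = ‖conj a * f ζ‖ := by rw [sub_eq_zero.1 h]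
    simp only [norm_pow, Complex.norm_real, Real.norm_eq_abs, sq_abs, norm_mul,
      RCLike.norm_conj] at h'
    nlinarith [hM ζ hζ, norm_nonneg a]
  -- `f / M` followed by the disc automorphism that moves `a / M` to `0`.
  let g : ℂ → ℂ := fun ζ => M * (f ζ - a) / ((M : ℂ) ^ 2 - conj a * f ζ)
  have hg : DifferentiableOn ℂ g (Metric.ball 0 1) := by
    refine DifferentiableOn.div ?_ ?_ hden <;> fun_prop
  have hmaps : Set.MapsTo g (Metric.ball 0 1) (Metric.closedBall (g 0) 1) := fun ζ hζ => by
    have hg0 : g 0 = 0 := by simp [g, ha]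
    rw [hg0, mem_closedBall_zero_iff, norm_div, div_le_one (norm_pos_iff.2 (hden ζ hζ))]
    refine le_of_sq_le_sq ?_ (norm_nonneg _)
    have h1 := hM ζ hζ
    -- This product equals `|M² - ā f ζ|² - M² |f ζ - a|²`.
    have h2 : 0 ≤ (M ^ 2 - ‖a‖ ^ 2) * (M ^ 2 - ‖f ζ‖ ^ 2) :=
      mul_nonneg (by nlinarith [norm_nonneg a]) (by nlinarith [norm_nonneg (f ζ)])
    simp only [Complex.sq_norm, Complex.normSq_apply] at h2 ⊢
    simp [pow_two] at h2 ⊢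
    nlinarith [h2]
  have h1 := Complex.norm_deriv_le_div_of_mapsTo_ball hg hmaps one_pos
  have hpos : 0 < M ^ 2 - ‖a‖ ^ 2 := by nlinarith [norm_nonneg a]
  have hconj : (M : ℂ) ^ 2 - conj a * a = ((M ^ 2 - ‖a‖ ^ 2 : ℝ) : ℂ) := by
    push_cast; rw [Complex.conj_mul']
  have hne : ((M ^ 2 - ‖a‖ ^ 2 : ℝ) : ℂ) ≠ 0 := by exact_mod_cast hpos.ne'
  have hf := (hd 0).hasDerivAt
  have hder : HasDerivAt g (M * deriv f 0 / ((M ^ 2 - ‖a‖ ^ 2 : ℝ) : ℂ)) 0 := by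
    have h := ((hf.sub_const a).const_mul (M : ℂ)).div
      ((hf.const_mul (conj a)).const_sub ((M : ℂ) ^ 2)) (hden 0 (by simp))
    refine h.congr_deriv ?_
    rw [← ha, hconj]
    field_simp
    simp
  rw [hder.deriv, norm_div, norm_mul, Complex.norm_real, Complex.norm_real,
    Real.norm_of_nonneg hM0.le, Real.norm_of_nonneg hpos.le, div_one, div_le_one hpos] at h1
  exact h1

/-- The first order Taylor coefficients of a polynomial bounded on the polydisc. -/
theorem mul_sum_norm_pderiv_le {n : ℕ} (p : MvPolynomial (Fin n) ℂ) {M : ℝ}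
    (hM : polydiscNorm p < M) :
    M * ∑ i, ‖MvPolynomial.eval 0 (MvPolynomial.pderiv i p)‖ ≤
      M ^ 2 - ‖MvPolynomial.eval 0 p‖ ^ 2 := by
  have hle : ∀ z ∈ closedPolydisc n, ‖MvPolynomial.eval z p‖ ≤ polydiscNorm p := fun z hz =>
    le_csSup (bddAbove_polydisc p) ⟨z, hz, rfl⟩
  have h0 : ‖MvPolynomial.eval 0 p‖ ≤ polydiscNorm p := hle 0 (by simp [closedPolydisc])
  -- Unimodular `z i` rotate each partial derivative onto its absolute value, so the derivative
  -- along `z` is the sum of absolute values.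
  choose z hz hzg using fun i =>
    Complex.exists_norm_eq_mul_self (MvPolynomial.eval 0 (MvPolynomial.pderiv i p))
  have h := mul_norm_deriv_zero_le (f := fun ζ : ℂ => MvPolynomial.eval (ζ • z) p) (M := M)
    (differentiable_eval_smul p z)
    (fun ζ hζ => (hle _ fun i => by simpa [hz] using (mem_ball_zero_iff.1 hζ).le).trans hM.le)
    (by rw [zero_smul]; exact h0.trans_lt hM)
  simp only [(hasDerivAt_eval_smul p z).deriv, ← hzg, zero_smul] at h
  rwa [← Complex.ofReal_sum, Complex.norm_real, Real.norm_of_nonneg (by positivity)] at h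

/-- The norm of a scalar plus a square zero operator of rank one. -/
theorem norm_smul_one_add_rankOne_le {H : Type*} [NormedAddCommGroup H] [InnerProductSpace ℂ H]
    {e w : H} (he : ‖e‖ = 1) (hew : ⟪e, w⟫_ℂ = 0) {a : ℂ} {M : ℝ} (hM : 0 < M)
    (h : M * ‖w‖ ≤ M ^ 2 - ‖a‖ ^ 2) :
    ‖a • (1 : H →L[ℂ] H) + InnerProductSpace.rankOne ℂ w e‖ ≤ M := by
  refine ContinuousLinearMap.opNorm_le_bound _ hM.le fun x => ?_
  set c : ℂ := ⟪e, x⟫_ℂ with hc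
  set y : H := x - c • e with hy
  have hxy : x = c • e + y := by simp [hy]
  have hey : ⟪e, y⟫_ℂ = 0 := by simp [hy, he, hc]
  have hTx : (a • (1 : H →L[ℂ] H) + InnerProductSpace.rankOne ℂ w e) x =
      (a * c) • e + (a • y + c • w) := by
    conv_lhs => simp [← hc]
    rw [hxy, smul_add, smul_smul, add_assoc]
  have n1 : ‖x‖ ^ 2 = ‖c‖ ^ 2 + ‖y‖ ^ 2 := by
    rw [hxy, sq, norm_add_sq_eq_norm_sq_add_norm_sq_of_inner_eq_zero (𝕜 := ℂ) _ _
      (by simp [inner_smul_left, hey]), norm_smul, he]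
    ring
  have n2 : ‖(a • (1 : H →L[ℂ] H) + InnerProductSpace.rankOne ℂ w e) x‖ ^ 2 =
      ‖a‖ ^ 2 * ‖c‖ ^ 2 + ‖a • y + c • w‖ ^ 2 := by
    rw [hTx, sq, norm_add_sq_eq_norm_sq_add_norm_sq_of_inner_eq_zero (𝕜 := ℂ) _ _
      (by simp [inner_smul_left, inner_add_right, inner_smul_right, hey, hew]), norm_smul, he,
      norm_mul]
    ring
  have n3 : ‖a • y + c • w‖ ≤ ‖a‖ * ‖y‖ + ‖c‖ * ‖w‖ := by
    simpa only [norm_smul] using norm_add_le (a • y) (c • w)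
  have n4 : ‖a • y + c • w‖ ^ 2 ≤ (‖a‖ * ‖y‖ + ‖c‖ * ‖w‖) ^ 2 := by gcongr
  refine le_of_sq_le_sq ?_ (by positivity)
  rw [n2, mul_pow, n1]
  have hb : 0 ≤ ‖w‖ := norm_nonneg w
  generalize ‖a‖ = α at *
  generalize ‖w‖ = b at *
  generalize ‖c‖ = s at *
  generalize ‖y‖ = t at *
  -- `M` times the right side is `(αs - Mt)² + (M² - α² - Mb)s²`.
  have n5 : 0 ≤ (M - b) * s ^ 2 + M * t ^ 2 - 2 * α * s * t := by
    refine nonneg_of_mul_nonneg_right (a := M) ?_ hM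
    nlinarith [sq_nonneg (α * s - M * t), mul_nonneg (sub_nonneg.2 h) (sq_nonneg s)]
  -- The gap `M²(s² + t²) - α²s² - (αt + sb)²` equals `(M² - α² - Mb)(s² + t²)` plus `b` times the
  -- expression in `n5`.
  nlinarith [mul_nonneg hb n5, mul_nonneg (sub_nonneg.2 h) (sq_nonneg s),
    mul_nonneg (sub_nonneg.2 h) (sq_nonneg t)]

/-- Square zero contractions of rank one with a common initial vector satisfy the von Neumann
inequality. -/
theorem satisfiesVonNeumann_rankOne {n : ℕ} {H : Type*} [NormedAddCommGroup H]
    [InnerProductSpace ℂ H] {e : H} (he : ‖e‖ = 1) (v : Fin n → H) (hv : ∀ i, ‖v i‖ ≤ 1)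
    (hev : ∀ i, ⟪e, v i⟫_ℂ = 0) :
    SatisfiesVonNeumann fun i => InnerProductSpace.rankOne ℂ (v i) e := by
  intro p
  -- Taking `M` strictly above the supremum gives the strict bound `|p(0)| < M` needed for
  -- Schwarz–Pick, even for constant `p`.
  refine le_of_forall_gt_imp_ge_of_dense fun M hM => ?_
  have hM0 : 0 < M :=
    ((norm_nonneg _).trans (le_csSup (bddAbove_polydisc p)
      ⟨0, by simp [closedPolydisc], rfl⟩)).trans_lt hM
  rw [polyEval_of_mul_eq_zero _ (fun i j => by ext x; simp [hev])]
  have hsum : ∑ i, MvPolynomial.eval 0 (MvPolynomial.pderiv i p) •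
      InnerProductSpace.rankOne ℂ (v i) e = InnerProductSpace.rankOne ℂ
        (∑ i, MvPolynomial.eval 0 (MvPolynomial.pderiv i p) • v i) e := by
    simp
  rw [hsum]
  refine norm_smul_one_add_rankOne_le he ?_ hM0 (le_trans ?_ (mul_sum_norm_pderiv_le p hM))
  · simp [hev]
  · gcongr
    refine norm_sum_le_of_le _ fun i _ => ?_
    rw [norm_smul]
    exact mul_le_of_le_one_right (norm_nonneg _) (hv i)

/-- A coextension to isometries agrees with the original operator on norm attaining vectors. -/
theorem apply_eq_of_adjoint_apply_eq {H K : Type*} [NormedAddCommGroup H] [InnerProductSpace ℂ H]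
    [CompleteSpace H] [NormedAddCommGroup K] [InnerProductSpace ℂ K] [CompleteSpace K]
    (J : H →ₗᵢ[ℂ] K) {T : H →L[ℂ] H} {V : K →L[ℂ] K} (hV : Isometry V)
    (hVT : ∀ x, ContinuousLinearMap.adjoint V (J x) = J (ContinuousLinearMap.adjoint T x))
    {x : H} (hx : ‖T x‖ = ‖x‖) : V (J x) = J (T x) := by
  have hnorm : ‖V (J x)‖ = ‖x‖ := by
    rw [(AddMonoidHomClass.isometry_iff_norm V).1 hV, J.norm_map]
  -- This is the equality case of Cauchy–Schwarz: both vectors have norm `‖x‖`.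
  have hin : ⟪J (T x), V (J x)⟫_ℂ = ((‖x‖ ^ 2 : ℝ) : ℂ) := by
    rw [← ContinuousLinearMap.adjoint_inner_left, hVT, J.inner_map_map,
      ContinuousLinearMap.adjoint_inner_left, inner_self_eq_norm_sq_to_K, hx]
    simp
  rw [← sub_eq_zero, ← norm_eq_zero, ← sq_eq_zero_iff, norm_sub_sq (𝕜 := ℂ),
    ← inner_re_symm, hin, hnorm, J.norm_map, hx, RCLike.re_to_complex, Complex.ofReal_re]
  ring

/-- Commuting isometries cannot send a vector to the four given combinations of an orthogonal pair
with unit first member. -/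
theorem false_of_commuting_isometries {K : Type*} [NormedAddCommGroup K] [InnerProductSpace ℂ K]
    (V : Fin 4 → (K →L[ℂ] K)) (hV : ∀ i, Isometry (V i)) (hc : ∀ i j, Commute (V i) (V j))
    {e f g : K} (hf : ‖f‖ = 1) (hfg : ⟪f, g⟫_ℂ = 0) (h0 : V 0 e = f)
    (h1 : V 1 e = g) (h2 : V 2 e = (3 / 5 : ℂ) • f + (4 / 5 : ℂ) • g)
    (h3 : V 3 e = (3 / 5 : ℂ) • f + (4 / 5 * Complex.I) • g) : False := by
  have hin : ∀ i x y, ⟪V i x, V i y⟫_ℂ = ⟪x, y⟫_ℂ := fun i =>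
    (LinearMap.norm_map_iff_inner_map_map (V i)).1
      ((AddMonoidHomClass.isometry_iff_norm (V i)).1 (hV i))
  have hcomm : ∀ i j x, V i (V j x) = V j (V i x) := fun i j x => DFunLike.congr_fun (hc i j).eq x
  have e1 : V 0 g = V 1 f := by rw [← h0, ← h1, hcomm]
  have e2f : V 2 f = (3 / 5 : ℂ) • V 0 f + (4 / 5 : ℂ) • V 0 g := by
    rw [← map_smul, ← map_smul, ← map_add, ← h2, hcomm, h0]
  have e2g : V 2 g = (3 / 5 : ℂ) • V 1 f + (4 / 5 : ℂ) • V 1 g := by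
    rw [← map_smul, ← map_smul, ← map_add, ← h2, hcomm, h1]
  have e3f : V 3 f = (3 / 5 : ℂ) • V 0 f + (4 / 5 * Complex.I) • V 0 g := by
    rw [← map_smul, ← map_smul, ← map_add, ← h3, hcomm, h0]
  have e3g : V 3 g = (3 / 5 : ℂ) • V 1 f + (4 / 5 * Complex.I) • V 1 g := by
    rw [← map_smul, ← map_smul, ← map_add, ← h3, hcomm, h1]
  have i0 : ⟪V 0 f, V 1 f⟫_ℂ = 0 := by rw [← e1, hin, hfg]
  have i1 : ⟪V 1 f, V 1 g⟫_ℂ = 0 := by rw [hin, hfg]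
  have i2 : ⟪V 1 f, V 1 f⟫_ℂ = 1 := by rw [hin, inner_self_eq_norm_sq_to_K, hf]; simp
  -- With `t = ⟪V 0 f, V 1 g⟫`, orthogonality of `V 2 f` and `V 2 g` means `t + 1 = 0`. For `V 3`
  -- the factor `I`, conjugated in the first slot only, turns this into `t - 1 = 0`.
  have k2 := hin 2 f g
  have k3 := hin 3 f g
  rw [e2f, e2g, e1, hfg] at k2
  rw [e3f, e3g, e1, hfg] at k3
  simp only [inner_add_left, inner_add_right, inner_smul_left, inner_smul_right, i0, i1, i2] at k2 k3
  simp [Complex.conj_ofNat] at k2 k3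
  have : ⟪V 0 f, V 1 g⟫_ℂ = -1 := by linear_combination 25 / 12 * k2
  rw [this] at k3
  have h := congrArg Complex.im k3
  norm_num at h

/-- The matrix `v e*` acts as an operator of rank one. -/
theorem toEuclideanCLM_vecMulVec {n : Type*} [Fintype n] [DecidableEq n]
    (v e : EuclideanSpace ℂ n) :
    Matrix.toEuclideanCLM (n := n) (𝕜 := ℂ) (Matrix.vecMulVec v (star e)) =
      InnerProductSpace.rankOne ℂ v e := by
  ext x i
  simp [Matrix.ofLp_toEuclideanCLM, Matrix.vecMulVec_mulVec,
    EuclideanSpace.inner_eq_star_dotProduct, dotProduct_comm, mul_comm]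

theorem mainTheorem11 :
    ∃ A : Fin 4 → Matrix (Fin 3) (Fin 3) ℂ,
      (∀ i j, Commute (A i) (A j)) ∧
      (∀ i, ‖Matrix.toEuclideanCLM (n := Fin 3) (𝕜 := ℂ) (A i)‖ ≤ 1) ∧
      SatisfiesVonNeumann (fun i => Matrix.toEuclideanCLM (n := Fin 3) (𝕜 := ℂ) (A i)) ∧
      ¬ CoextendsToCommutingIsometries.{u, 0}
        (fun i => Matrix.toEuclideanCLM (n := Fin 3) (𝕜 := ℂ) (A i)) := by
  let e : EuclideanSpace ℂ (Fin 3) := EuclideanSpace.single 0 1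
  let f : EuclideanSpace ℂ (Fin 3) := EuclideanSpace.single 1 1
  let g : EuclideanSpace ℂ (Fin 3) := EuclideanSpace.single 2 1
  -- The triple 3, 4, 5 gives unit vectors with rational moduli of coordinates.
  let v : Fin 4 → EuclideanSpace ℂ (Fin 3) :=
    ![f, g, (3 / 5 : ℂ) • f + (4 / 5 : ℂ) • g, (3 / 5 : ℂ) • f + (4 / 5 * Complex.I) • g]
  have he : ‖e‖ = 1 := by simp [e]
  have hf : ‖f‖ = 1 := by simp [f]
  have hfg : ⟪f, g⟫_ℂ = 0 := by simp [f, g, PiLp.inner_apply]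
  have hv : ∀ i, ‖v i‖ = 1 := by
    intro i
    rw [EuclideanSpace.norm_eq, Real.sqrt_eq_one]
    fin_cases i <;>
      norm_num [v, f, g, Fin.sum_univ_three, Pi.single_apply, Fin.ext_iff]
  have hev : ∀ i, ⟪e, v i⟫_ℂ = 0 := by
    intro i
    fin_cases i <;>
      simp [v, e, f, g, PiLp.inner_apply]
  have hzero : ∀ i j, InnerProductSpace.rankOne ℂ (v i) e * InnerProductSpace.rankOne ℂ (v j) e =
      0 := fun i j => by ext x; simp [hev]
  refine ⟨fun i => Matrix.vecMulVec (v i) (star e), ?_, ?_, ?_, ?_⟩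
  · intro i j
    apply (Matrix.toEuclideanCLM (n := Fin 3) (𝕜 := ℂ)).injective
    rw [map_mul, map_mul]
    exact (congrArg₂ _ (toEuclideanCLM_vecMulVec _ _) (toEuclideanCLM_vecMulVec _ _)).trans
      ((hzero i j).trans (hzero j i).symm) |>.trans
      (congrArg₂ _ (toEuclideanCLM_vecMulVec _ _) (toEuclideanCLM_vecMulVec _ _)).symm
  · intro i
    simp [toEuclideanCLM_vecMulVec, hv, he]
  · simp only [toEuclideanCLM_vecMulVec]
    exact satisfiesVonNeumann_rankOne he v (fun i => (hv i).le) hev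
  · simp only [toEuclideanCLM_vecMulVec]
    rintro ⟨K, _, _, _, J, V, hV, hc, hVT⟩
    have hVe : ∀ i, V i (J e) = J (v i) := fun i => by
      have hT : InnerProductSpace.rankOne ℂ (v i) e e = v i := by simp [he]
      rw [apply_eq_of_adjoint_apply_eq J (hV i) (hVT i) (by rw [hT, hv, he]), hT]
    refine false_of_commuting_isometries V hV hc (e := J e) (f := J f) (g := J g)
      (by rw [J.norm_map, hf]) (by rw [J.inner_map_map, hfg])
      (hVe 0) (hVe 1) ?_ ?_
    · rw [hVe, ← map_smul, ← map_smul, ← map_add]; rfl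
    · rw [hVe, ← map_smul, ← map_smul, ← map_add]; rfl
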